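/- Let $E$ and $F$ be complex Banach spaces, let $U\subseteq E$ be open and let $1<p\le\infty$, with conjugate index $p^*$ ($1/p+1/p^*=1$, $p^*=1$ if $p=\infty$). For a complex Banach space $G$, let $\mathcal H^\infty(U,G)$ be the space of bounded holomorphic mappings $g\colon U\to G$ with the norm $\|g\|_\infty=\sup_{x\in U}\|g(x)\|$ (equal to $0$ if $U=\emptyset$), and let $\mathcal H^\infty(U)=\mathcal H^\infty(U,\mathbb C)$. For $y_1^*,\dots,y_n^*\in F^*$ put $w_{p^*}(y_1^*,\dots,y_n^*)=\sup_{y^{**}\in B_{F^{**}}}\big(\sum_{i=1}^n|y^{**}(y_i^*)|^{p^*}\big)^{1/p^*}$. For $p=\infty$, $\big(\sum_{i}a_i^p\big)^{1/p}$ below means $\max_{i}a_i$. A bounded linear operator $T\colon G\to F$ is strongly $p$-summing, $T\in\mathcal D_p(G,F)$, if there is $C\ge 0$ such that $$\sum_{i=1}^n|\langle y_i^*,T(x_i)\rangle|\le C\Big(\sum_{i=1}^n\|x_i\|^p\Big)^{1/p}w_{p^*}(y_1^*,\dots,y_n^*)$$ for all $n\in\mathbb N$, $x_1,\dots,x_n\in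 G$ and $y_1^*,\dots,y_n^*\in F^*$; $d_p(T)$ is the infimum of such $C$. A holomorphic mapping $f\colon U\to F$ is Cohen strongly $p$-summing if there is $C\ge 0$ such that $$\sum_{i=1}^n|\lambda_i|\,|\langle y_i^*,f(x_i)\rangle|\le C\Big(\sum_{i=1}^n|\lambda_i|^p\Big)^{1/p}w_{p^*}(y_1^*,\dots,y_n^*)$$ for all $n\in\mathbb N$, $\lambda_1,\dots,\lambda_n\in\mathbb C$, $x_1,\dots,x_n\in U$ and $y_1^*,\dots,y_n^*\in F^*$; $d_p^{\mathcal H^\infty}(f)$ is the infimum of such $C$. Let $\mathcal G^\infty(U)$ be the norm-closed linear hull in $\mathcal H^\infty(U)^*$ of the evaluation functionals $\delta(x)$, $x\in U$, and let $g_U\colon U\to\mathcal G^\infty(U)$, $g_U(x)=\delta(x)$. **Theorem.** Let $f\in\mathcal H^\infty(U,F)$. Then $f$ is Cohen strongly $p$-summing holomorphic if and only if $f=T\circ g$ for some complex Banach space $G$, some $g\in\mathcal H^\infty(U,G)$ and some $T\in\mathcal D_p(G,F)$. In this case, $$d_p^{\mathcal H^\infty}(f)=\inf\{d_p(T)\,\|g\|_\infty\},$$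 where the infimum is taken over all such factorizations $f=T\circ g$, and the infimum is attained at Mujica's factorization $f=T_f\circ g_U$: $g_U\in\mathcal H^\infty(U,\mathcal G^\infty(U))$, there is a unique bounded linear operator $T_f\colon\mathcal G^\infty(U)\to F$ with $T_f\circ g_U=f$, it is strongly $p$-summing, and $d_p(T_f)\,\|g_U\|_\infty=d_p^{\mathcal H^\infty}(f)$. -/

import Mathlib

open TopologicalSpace
open scoped ENNReal BoundedContinuousFunction

universe u v w

noncomputable section

namespace CohenHolomorphic

/-- A mapping `f : U → F` on an open set is holomorphic if it is complex Fréchet differentiable at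
every point of `U`; this is phrased through an extension of `f` to the whole space, whose values
off the open set `U` play no role. -/
def IsHolomorphic {E : Type u} [NormedAddCommGroup E] [NormedSpace ℂ E]
    {F : Type v} [NormedAddCommGroup F] [NormedSpace ℂ F] {U : Opens E} (f : U → F) : Prop :=
  ∃ g : E → F, DifferentiableOn ℂ g (U : Set E) ∧ ∀ x : U, g x = f x

/-- The bounded holomorphic mappings from `U` to `F`, as a subspace of the bounded continuous
mappings (holomorphic mappings are continuous). -/
def hinfSubmodule {E : Type u} [NormedAddCommGroup E] [NormedSpace ℂ E] (U : Opens E)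
    (F : Type v) [NormedAddCommGroup F] [NormedSpace ℂ F] : Submodule ℂ (U →ᵇ F) where
  carrier := {f | IsHolomorphic (f : U → F)}
  zero_mem' := ⟨fun _ => 0, differentiableOn_const 0, fun _ => rfl⟩
  add_mem' := by
    rintro f₁ f₂ ⟨g₁, h₁, e₁⟩ ⟨g₂, h₂, e₂⟩
    exact ⟨fun x => g₁ x + g₂ x, h₁.add h₂, fun x => by simp [e₁ x, e₂ x]⟩
  smul_mem' := by
    rintro c f ⟨g, h, e⟩
    exact ⟨fun x => c • g x, h.const_smul c, fun x => by simp [e x]⟩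

/-- The space `ℋ^∞(U, F)` of bounded holomorphic mappings from `U` to `F`, with the supremum norm
`‖f‖_∞ = sup {‖f x‖ : x ∈ U}` (inherited from the bounded continuous mappings). -/
def Hinf {E : Type u} [NormedAddCommGroup E] [NormedSpace ℂ E] (U : Opens E)
    (F : Type v) [NormedAddCommGroup F] [NormedSpace ℂ F] : Type (max u v) :=
  hinfSubmodule U F

instance {E : Type u} [NormedAddCommGroup E] [NormedSpace ℂ E] (U : Opens E)
    (F : Type v) [NormedAddCommGroup F] [NormedSpace ℂ F] : NormedAddCommGroup (Hinf U F) :=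
  inferInstanceAs (NormedAddCommGroup (hinfSubmodule U F))

instance {E : Type u} [NormedAddCommGroup E] [NormedSpace ℂ E] (U : Opens E)
    (F : Type v) [NormedAddCommGroup F] [NormedSpace ℂ F] : NormedSpace ℂ (Hinf U F) :=
  inferInstanceAs (NormedSpace ℂ (hinfSubmodule U F))

instance {E : Type u} [NormedAddCommGroup E] [NormedSpace ℂ E] (U : Opens E)
    (F : Type v) [NormedAddCommGroup F] [NormedSpace ℂ F] :
    CoeFun (Hinf U F) (fun _ => U → F) :=
  ⟨fun f => (f.1 : U → F)⟩

theorem Hinf.norm_eq {E : Type u} [NormedAddCommGroup E] [NormedSpace ℂ E] {U : Opens E}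
    {F : Type v} [NormedAddCommGroup F] [NormedSpace ℂ F] (f : Hinf U F) : ‖f‖ = ⨆ x : U, ‖f x‖ :=
  BoundedContinuousFunction.norm_eq_iSup_norm f.1

/-- The evaluation functional `δ(x)` on `ℋ^∞(U)`. -/
def delta {E : Type u} [NormedAddCommGroup E] [NormedSpace ℂ E] (U : Opens E) (x : U) :
    StrongDual ℂ (Hinf U ℂ) :=
  LinearMap.mkContinuous
    { toFun := fun f => f x
      map_add' := fun _ _ => rfl
      map_smul' := fun _ _ => rfl } 1
    (fun f => (BoundedContinuousFunction.norm_coe_le_norm f.1 x).trans (one_mul ‖f‖).ge)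

/-- The norm-closed linear hull of the evaluation functionals in `ℋ^∞(U)^*`. -/
def ginfSubmodule {E : Type u} [NormedAddCommGroup E] [NormedSpace ℂ E] (U : Opens E) :
    Submodule ℂ (StrongDual ℂ (Hinf U ℂ)) :=
  (Submodule.span ℂ (Set.range (delta U))).topologicalClosure

/-- The space `𝒢^∞(U)`, with the norm of `ℋ^∞(U)^*`. -/
def Ginf {E : Type u} [NormedAddCommGroup E] [NormedSpace ℂ E] (U : Opens E) : Type u :=
  ginfSubmodule U

instance {E : Type u} [NormedAddCommGroup E] [NormedSpace ℂ E] (U : Opens E) :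
    NormedAddCommGroup (Ginf U) :=
  inferInstanceAs (NormedAddCommGroup (ginfSubmodule U))

instance {E : Type u} [NormedAddCommGroup E] [NormedSpace ℂ E] (U : Opens E) :
    NormedSpace ℂ (Ginf U) :=
  inferInstanceAs (NormedSpace ℂ (ginfSubmodule U))

instance {E : Type u} [NormedAddCommGroup E] [NormedSpace ℂ E] (U : Opens E) :
    CompleteSpace (Ginf U) :=
  (Submodule.isClosed_topologicalClosure
    (Submodule.span ℂ (Set.range (delta U)))).completeSpace_coe

/-- The mapping `g_U : U → 𝒢^∞(U)`, `g_U(x) = δ(x)`. -/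
def gU {E : Type u} [NormedAddCommGroup E] [NormedSpace ℂ E] (U : Opens E) (x : U) : Ginf U :=
  ⟨delta U x, Submodule.le_topologicalClosure _ (Submodule.subset_span ⟨x, rfl⟩)⟩

/-- The `ℓ_p^n`-norm `(∑ ‖xᵢ‖^p)^(1/p)` (or `max ‖xᵢ‖` if `p = ∞`) of a finite family. -/
def lpNorm {X : Type u} [NormedAddCommGroup X] (p : ℝ≥0∞) {n : ℕ} (x : Fin n → X) : ℝ :=
  ‖(WithLp.toLp p x : PiLp p (fun _ : Fin n => X))‖

/-- The weak norm `sup {‖(y**(y*ᵢ))ᵢ‖_q : y** ∈ B_{F**}}` of a finite family in `F*`. -/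
def weakNorm {F : Type v} [NormedAddCommGroup F] [NormedSpace ℂ F] (q : ℝ≥0∞) {n : ℕ}
    (y : Fin n → StrongDual ℂ F) : ℝ :=
  ⨆ φ : Metric.closedBall (0 : StrongDual ℂ (StrongDual ℂ F)) 1,
    lpNorm q (fun i => (φ : StrongDual ℂ (StrongDual ℂ F)) (y i))

/-- The constants `C ≥ 0` admissible in the definition of a strongly `p`-summing operator. -/
def linearConstants {G : Type u} [NormedAddCommGroup G] [NormedSpace ℂ G]
    {F : Type v} [NormedAddCommGroup F] [NormedSpace ℂ F] (p : ℝ≥0∞) (T : G →L[ℂ] F) : Set ℝ :=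
  {C | 0 ≤ C ∧ ∀ (n : ℕ) (x : Fin n → G) (y : Fin n → StrongDual ℂ F),
    ∑ i, ‖y i (T (x i))‖ ≤ C * lpNorm p x * weakNorm p.conjExponent y}

/-- `T ∈ 𝒟_p(G, F)`: the operator `T` is strongly `p`-summing. -/
def IsStronglySumming {G : Type u} [NormedAddCommGroup G] [NormedSpace ℂ G]
    {F : Type v} [NormedAddCommGroup F] [NormedSpace ℂ F] (p : ℝ≥0∞) (T : G →L[ℂ] F) : Prop :=
  (linearConstants p T).Nonempty

/-- The norm `d_p(T)`. -/
def dLinear {G : Type u} [NormedAddCommGroup G] [NormedSpace ℂ G]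
    {F : Type v} [NormedAddCommGroup F] [NormedSpace ℂ F] (p : ℝ≥0∞) (T : G →L[ℂ] F) : ℝ :=
  sInf (linearConstants p T)

/-- The constants `C ≥ 0` admissible in the definition of a Cohen strongly `p`-summing mapping. -/
def holomorphicConstants {E : Type u} [NormedAddCommGroup E] [NormedSpace ℂ E] {U : Opens E}
    {F : Type v} [NormedAddCommGroup F] [NormedSpace ℂ F] (p : ℝ≥0∞) (f : U → F) : Set ℝ :=
  {C | 0 ≤ C ∧ ∀ (n : ℕ) (l : Fin n → ℂ) (x : Fin n → U) (y : Fin n → StrongDual ℂ F),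
    ∑ i, ‖l i‖ * ‖y i (f (x i))‖ ≤ C * lpNorm p l * weakNorm p.conjExponent y}

/-- `f ∈ 𝒟_p^{ℋ^∞}(U, F)`: `f` is a Cohen strongly `p`-summing holomorphic mapping. -/
def IsCohenStronglySumming {E : Type u} [NormedAddCommGroup E] [NormedSpace ℂ E] {U : Opens E}
    {F : Type v} [NormedAddCommGroup F] [NormedSpace ℂ F] (p : ℝ≥0∞) (f : U → F) : Prop :=
  IsHolomorphic f ∧ (holomorphicConstants p f).Nonempty

/-- The norm `d_p^{ℋ^∞}(f)`. -/
def dHolomorphic {E : Type u} [NormedAddCommGroup E] [NormedSpace ℂ E] {U : Opens E}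
    {F : Type v} [NormedAddCommGroup F] [NormedSpace ℂ F] (p : ℝ≥0∞) (f : U → F) : ℝ :=
  sInf (holomorphicConstants p f)

end CohenHolomorphic

end

namespace CohenHolomorphic

open Metric Set Filter Topology

/-! ### Bounded holomorphic mappings, holomorphy of `gU`, and Mujica's linearization -/

section Hinf

variable {E : Type u} [NormedAddCommGroup E] [NormedSpace ℂ E] {U : Opens E}
  {F : Type v} [NormedAddCommGroup F] [NormedSpace ℂ F]

/-! Every bounded holomorphic `f` factors as `T_f ∘ g_U` with `‖g_U‖ ≤ 1`, and the summing
inequality for `f` passes to `T_f` with the same constant. Indeed `⟨y, T_f φ⟩ = φ(y ∘ f)`, so `|⟨y,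
T_f φ⟩| ≤ ‖φ‖ sup_x |y(f x)|`; picking points `x_i` that nearly attain these suprema and `λ_i =
‖φ_i‖` reduces the linear inequality to the holomorphic one
(`holomorphicConstants_subset_linearization`). Conversely, testing `T` on the vectors `λ_i g(x_i)`
gives `d_p(T ∘ g) ≤ d_p(T) ‖g‖` for every factorization (`dHolomorphic_comp_le`). The two bounds
make Mujica's factorization optimal.

The analytic input is the holomorphy of `g_U`: a second-order Taylor bound linear in `‖f‖` is an
estimate in the norm of `ℋ^∞(U)^*`. The existence of `T_f` rests on `F` being closed in `F**`. -/

theorem Hinf.norm_apply_le (f : Hinf U F) (x : U) : ‖f x‖ ≤ ‖f‖ :=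
  BoundedContinuousFunction.norm_coe_le_norm f.1 x

theorem Hinf.norm_le (f : Hinf U F) {C : ℝ} (hC : 0 ≤ C) (h : ∀ x, ‖f x‖ ≤ C) : ‖f‖ ≤ C :=
  (BoundedContinuousFunction.norm_le hC).2 h

theorem Hinf.ext {f g : Hinf U F} (h : ∀ x, f x = g x) : f = g :=
  Subtype.ext (BoundedContinuousFunction.ext h)

theorem IsHolomorphic.continuous {f : U → F} (hf : IsHolomorphic f) : Continuous f := by
  obtain ⟨g, hg, e⟩ := hf
  have : f = (U : Set E).domRestrict g := funext fun x => (e x).symm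
  rw [this]
  exact hg.continuousOn.domRestrict

/-- A bounded holomorphic mapping as an element of `ℋ^∞(U, F)`. -/
noncomputable def Hinf.ofBounded (f : U → F) (hf : IsHolomorphic f) (C : ℝ) (hC : ∀ x, ‖f x‖ ≤ C) : Hinf U F :=
  ⟨BoundedContinuousFunction.ofNormedAddCommGroup f hf.continuous C hC, hf⟩

/-- Composition of a bounded holomorphic mapping with a bounded operator. -/
noncomputable def Hinf.postcomp {G : Type w} [NormedAddCommGroup G] [NormedSpace ℂ G] (S : F →L[ℂ] G)
    (f : Hinf U F) : Hinf U G :=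
  Hinf.ofBounded (fun x => S (f x))
    (by
      obtain ⟨g, hg, e⟩ := f.2
      exact ⟨fun x => S (g x), S.differentiable.comp_differentiableOn hg, fun x => congrArg S (e x)⟩)
    (‖S‖ * ‖f‖) (fun x => S.le_opNorm_of_le (f.norm_apply_le x))

/-- The transpose `F^* → ℋ^∞(U)`, `y^* ↦ y^* ∘ f`, of a bounded holomorphic mapping. -/
noncomputable def Hinf.transpose (f : Hinf U F) : StrongDual ℂ F →L[ℂ] Hinf U ℂ :=
  LinearMap.mkContinuous
    { toFun := fun y => f.postcomp y
      map_add' := fun _ _ => rfl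
      map_smul' := fun _ _ => rfl } ‖f‖
    (fun y => Hinf.norm_le _ (by positivity) fun x => by
      rw [mul_comm]; exact y.le_opNorm_of_le (f.norm_apply_le x))

theorem Hinf.transpose_apply (f : Hinf U F) (y : StrongDual ℂ F) (x : U) :
    f.transpose y x = y (f x) := rfl

open Classical in
/-- The extension of a mapping by zero. -/
noncomputable def Hinf.extend (f : Hinf U F) (x : E) : F := if h : x ∈ U then f ⟨x, h⟩ else 0

theorem Hinf.extend_coe (f : Hinf U F) (x : U) : f.extend x = f x := by
  simp [Hinf.extend]

theorem Hinf.extend_add (f g : Hinf U F) : (f + g).extend = f.extend + g.extend := by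
  ext x
  by_cases h : x ∈ U
  · simp only [Hinf.extend, h, dif_pos, Pi.add_apply]; rfl
  · simp [Hinf.extend, h]

theorem Hinf.extend_smul (c : ℂ) (f : Hinf U F) : (c • f).extend = c • f.extend := by
  ext x
  by_cases h : x ∈ U
  · simp only [Hinf.extend, h, dif_pos, Pi.smul_apply]; rfl
  · simp [Hinf.extend, h]

theorem Hinf.norm_extend_le (f : Hinf U F) (x : E) : ‖f.extend x‖ ≤ ‖f‖ := by
  by_cases h : x ∈ U
  · simpa [Hinf.extend, h] using f.norm_apply_le ⟨x, h⟩
  · simp [Hinf.extend, h]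

theorem Hinf.differentiableOn_extend (f : Hinf U F) : DifferentiableOn ℂ f.extend (U : Set E) := by
  obtain ⟨g, hg, e⟩ := f.2
  refine hg.congr fun x hx => ?_
  exact (f.extend_coe ⟨x, hx⟩).trans (e ⟨x, hx⟩).symm

theorem Hinf.differentiableAt_extend (f : Hinf U F) (x : U) : DifferentiableAt ℂ f.extend x :=
  f.differentiableOn_extend.differentiableAt (U.isOpen.mem_nhds x.2)

/-- Schwarz lemma: on the ball, `f` stays within distance `2‖f‖` of its value at the centre. -/
theorem Hinf.norm_fderiv_extend_le (f : Hinf U F) {x : E} {r : ℝ} (hr : 0 < r)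
    (hb : ball x r ⊆ U) : ‖fderiv ℂ f.extend x‖ ≤ 2 * ‖f‖ / r := by
  refine Complex.norm_fderiv_le_div_of_mapsTo_ball (f.differentiableOn_extend.mono hb) ?_ hr
  intro z _
  rw [mem_closedBall, dist_eq_norm, two_mul]
  exact norm_sub_le_of_le (f.norm_extend_le z) (f.norm_extend_le x)

/-- A second order Taylor estimate, uniform on bounded sets of `ℋ^∞(U, F)`. -/
theorem Hinf.norm_extend_sub_sub_fderiv_le (f : Hinf U F) {x z : E} {r : ℝ}
    (hb : ball x r ⊆ U) (hz : z ∈ ball x r) :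
    ‖f.extend z - f.extend x - fderiv ℂ f.extend x (z - x)‖ ≤ 4 * ‖f‖ * (‖z - x‖ / r) ^ 2 := by
  have hr : 0 < r := nonempty_ball.1 ⟨z, hz⟩
  have hd := f.differentiableOn_extend.mono hb
  have hx : HasFDerivAt f.extend (fderiv ℂ f.extend x) x :=
    (hd.differentiableAt (ball_mem_nhds x hr)).hasFDerivAt
  set D := fderiv ℂ f.extend x
  -- Higher-order Schwarz lemma for the Taylor remainder, which is `o(‖z - x‖)` at the centre. The
  -- bound `4‖f‖` is `2‖f‖` for the increment plus `2‖f‖` for the linear term.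
  have key := Complex.dist_le_mul_div_pow_of_mapsTo_ball_of_isLittleO (n := 1) (c := x) (z := z)
    (f := fun y => f.extend y - f.extend x - D (y - x)) (R₁ := r) (R₂ := 4 * ‖f‖)
    ((hd.sub_const _).sub (D.differentiable.comp (differentiable_id.sub_const x)).differentiableOn)
    ?_ ?_ hz
  · simpa [dist_eq_norm] using key
  · intro y hy
    have h1 : ‖f.extend y - f.extend x‖ ≤ ‖f‖ + ‖f‖ :=
      norm_sub_le_of_le (f.norm_extend_le y) (f.norm_extend_le x)
    have h2 : ‖D (y - x)‖ ≤ 2 * ‖f‖ := by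
      calc ‖D (y - x)‖ ≤ 2 * ‖f‖ / r * r :=
            D.le_of_opNorm_le_of_le (f.norm_fderiv_extend_le hr hb) (mem_ball_iff_norm.1 hy).le
        _ = 2 * ‖f‖ := by field_simp
    have h3 := norm_sub_le (f.extend y - f.extend x) (D (y - x))
    simp only [mem_closedBall, dist_eq_norm, sub_self, map_zero, sub_zero]
    linarith
  · simpa using! hx.isLittleO.norm_right

/-- The derivative of `g_U` at `x`, as an operator into `ℋ^∞(U)^*`. -/
noncomputable def deltaDeriv (U : Opens E) (x : U) : E →L[ℂ] StrongDual ℂ (Hinf U ℂ) :=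
  ContinuousLinearMap.flip <|
  LinearMap.mkContinuousOfExistsBound
    { toFun := fun f : Hinf U ℂ => fderiv ℂ f.extend x
      map_add' := fun f g => by
        rw [Hinf.extend_add]
        exact fderiv_add (f.differentiableAt_extend x) (g.differentiableAt_extend x)
      map_smul' := fun c f => by
        rw [Hinf.extend_smul]
        exact fderiv_const_smul (f.differentiableAt_extend x) c }
    (by
      obtain ⟨r, hr, hb⟩ := Metric.isOpen_iff.1 U.isOpen x x.2
      exact ⟨2 / r, fun f => (f.norm_fderiv_extend_le hr hb).trans_eq (by ring)⟩)

theorem deltaDeriv_apply (x : U) (h : E) (f : Hinf U ℂ) :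
    deltaDeriv U x h f = fderiv ℂ f.extend x h := rfl

open Classical in
/-- The extension of `x ↦ δ(x)` by zero. -/
noncomputable def deltaExtend (U : Opens E) (x : E) : StrongDual ℂ (Hinf U ℂ) :=
  if h : x ∈ U then delta U ⟨x, h⟩ else 0

theorem deltaExtend_apply (x : E) (f : Hinf U ℂ) : deltaExtend U x f = f.extend x := by
  by_cases h : x ∈ U
  · simp only [deltaExtend, Hinf.extend, h, dif_pos]; rfl
  · simp [deltaExtend, Hinf.extend, h]

theorem deltaExtend_coe (x : U) : deltaExtend U x = delta U x := by
  simp [deltaExtend]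

/-- The Taylor remainder of each `f` is at most `‖f‖` times a multiple of `‖z - x‖ ^ 2` that does
not depend on `f`, so the same multiple bounds the dual norm of the remainder of `δ`. -/
theorem hasFDerivAt_deltaExtend (x : U) :
    HasFDerivAt (deltaExtend U) (deltaDeriv U x) (x : E) := by
  obtain ⟨r, hr, hb⟩ := Metric.isOpen_iff.1 U.isOpen x x.2
  refine HasFDerivAt.of_isLittleO ?_
  refine Asymptotics.IsBigO.trans_isLittleO (g := fun z : E => ‖z - x‖ ^ 2) ?_ ?_
  · refine Asymptotics.IsBigO.of_bound (4 / r ^ 2) ?_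
    filter_upwards [ball_mem_nhds (x : E) hr] with z hz
    refine ContinuousLinearMap.opNorm_le_bound _ (by positivity) fun f => ?_
    have := f.norm_extend_sub_sub_fderiv_le hb hz
    simp only [sub_apply, deltaExtend_apply, deltaDeriv_apply]
    refine this.trans_eq ?_
    rw [norm_pow, norm_norm]
    field_simp
  · have h0 : Tendsto (fun z : E => ‖z - (x : E)‖) (𝓝 (x : E)) (𝓝 0) := by
      have : Continuous fun z : E => ‖z - (x : E)‖ := by fun_prop
      simpa using this.tendsto (x : E)
    have := (Asymptotics.isLittleO_one_iff ℝ).2 h0 |>.mul_isBigO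
      (Asymptotics.isBigO_refl (fun z : E => ‖z - (x : E)‖) (𝓝 (x : E)))
    simpa [pow_two] using this

theorem deltaExtend_mem (x : E) : deltaExtend U x ∈ ginfSubmodule U := by
  by_cases h : x ∈ U
  · rw [deltaExtend, dif_pos h]
    exact (gU U ⟨x, h⟩).2
  · simp [deltaExtend, h]

/-- Directional derivatives are limits of difference quotients, which lie in the closed subspace. -/
theorem deltaDeriv_mem (x : U) (h : E) : deltaDeriv U x h ∈ ginfSubmodule U := by
  have hcl : IsClosed (ginfSubmodule U : Set (StrongDual ℂ (Hinf U ℂ))) :=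
    Submodule.isClosed_topologicalClosure _
  have hd := ((hasFDerivAt_deltaExtend x).hasLineDerivAt h).tendsto_slope_zero
  refine hcl.mem_of_tendsto hd (Eventually.of_forall fun t => ?_)
  exact (ginfSubmodule U).smul_mem _
    ((ginfSubmodule U).sub_mem (deltaExtend_mem _) (deltaExtend_mem _))

theorem isHolomorphic_gU (U : Opens E) : IsHolomorphic (gU U) := by
  refine ⟨fun x => ⟨deltaExtend U x, deltaExtend_mem x⟩, fun x hx => ?_,
    fun x => Subtype.ext (deltaExtend_coe x)⟩
  have hD := hasFDerivAt_deltaExtend ⟨x, hx⟩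
  have hD' : HasFDerivAt (fun z => (⟨deltaExtend U z, deltaExtend_mem z⟩ : ginfSubmodule U))
      ((deltaDeriv U ⟨x, hx⟩).codRestrict (ginfSubmodule U) (deltaDeriv_mem _)) x := by
    -- The subspace carries the ambient norm, so the remainder estimate transfers once stated for
    -- norms.
    have h := hD.isLittleO.norm_left
    refine (hasFDerivAt_iff_isLittleO (𝕜 := ℂ) (E := E) (F := ginfSubmodule U)).2 ?_
    rw [← Asymptotics.isLittleO_norm_left]
    exact h
  exact hD'.differentiableAt.differentiableWithinAt

theorem norm_gU_le (x : U) : ‖gU U x‖ ≤ 1 :=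
  LinearMap.mkContinuous_norm_le (𝕜₂ := ℂ) _ zero_le_one
    (fun f : Hinf U ℂ => (f.norm_apply_le x).trans (one_mul ‖f‖).ge)

/-- `g_U` as an element of `ℋ^∞(U, 𝒢^∞(U))`. -/
noncomputable def gUHinf (U : Opens E) : Hinf U (Ginf U) :=
  Hinf.ofBounded (gU U) (isHolomorphic_gU U) 1 norm_gU_le

theorem norm_gUHinf_le (U : Opens E) : ‖gUHinf U‖ ≤ 1 :=
  Hinf.norm_le _ zero_le_one norm_gU_le

theorem Ginf.hom_ext {S T : Ginf U →L[ℂ] F} (h : ∀ x, S (gU U x) = T (gU U x)) : S = T := by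
  have hd : Dense (Submodule.span ℂ (range (gU U)) : Set (Ginf U)) := by
    intro φ
    have hφ : (φ.1 : StrongDual ℂ (Hinf U ℂ)) ∈
        closure (Submodule.span ℂ (range (delta U)) : Set _) := φ.2
    refine (closure_subtype (p := (· ∈ ginfSubmodule U)) (x := φ)
      (s := (Submodule.span ℂ (range (gU U)) : Set (Ginf U)))).2 ?_
    refine closure_mono ?_ hφ
    have hr : range (delta U) = (ginfSubmodule U).subtype '' range (gU U) := by
      exact range_comp (ginfSubmodule U).subtype (gU U)
    rw [hr, Submodule.span_image]
    rfl
  refine ContinuousLinearMap.ext_on hd ?_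
  rintro _ ⟨x, rfl⟩
  exact h x

/-- The functional `y ↦ φ(y ∘ f)` in `F**` comes from `F`: for `φ = δ(x)` it is the image of `f x`,
and the property defines a closed subspace of `φ`, because `F` is complete and hence closed in
`F**`. -/
theorem Hinf.exists_linearization_apply [CompleteSpace F] (f : Hinf U F) (φ : Ginf U) :
    ∃ v : F, ∀ y : StrongDual ℂ F, y v = (φ.1 : StrongDual ℂ (Hinf U ℂ)) (f.transpose y) := by
  set J := NormedSpace.inclusionInDoubleDualLi (E := F) ℂ
  set R := LinearMap.range J.toLinearMap
  have hcl : IsClosed (R : Set (StrongDual ℂ (StrongDual ℂ F))) :=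
    J.isometry.isUniformInducing.isComplete_range.isClosed
  have hle : ginfSubmodule U ≤
      R.comap (ContinuousLinearMap.precomp ℂ f.transpose).toLinearMap := by
    refine Submodule.topologicalClosure_minimal _ (Submodule.span_le.2 ?_)
      (hcl.preimage (ContinuousLinearMap.precomp ℂ f.transpose).continuous)
    rintro _ ⟨x, rfl⟩
    exact ⟨f x, rfl⟩
  obtain ⟨v, hv⟩ := hle φ.2
  exact ⟨v, fun y => DFunLike.congr_fun hv y⟩

theorem Hinf.norm_transpose_le (f : Hinf U F) (y : StrongDual ℂ F) :
    ‖f.transpose y‖ ≤ ‖f‖ * ‖y‖ :=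
  f.transpose.le_of_opNorm_le (LinearMap.mkContinuous_norm_le _ (norm_nonneg f) _) y

/-- Mujica's linearization `T_f : 𝒢^∞(U) → F` of a bounded holomorphic mapping. -/
noncomputable def Hinf.linearization [CompleteSpace F] (f : Hinf U F) : Ginf U →L[ℂ] F :=
  LinearMap.mkContinuous
    { toFun := fun φ => (f.exists_linearization_apply φ).choose
      map_add' := fun φ ψ => by
        -- The chosen vector is determined by its pairings with `F*`, which are linear in `φ`.
        refine (SeparatingDual.eq_iff_forall_dual_eq (R := ℂ)).2 fun y => ?_
        rw [map_add, (f.exists_linearization_apply _).choose_spec,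
          (f.exists_linearization_apply _).choose_spec, (f.exists_linearization_apply _).choose_spec]
        rfl
      map_smul' := fun c φ => by
        refine (SeparatingDual.eq_iff_forall_dual_eq (R := ℂ)).2 fun y => ?_
        rw [map_smul, (f.exists_linearization_apply _).choose_spec,
          (f.exists_linearization_apply _).choose_spec]
        rfl } ‖f‖
    (fun φ => NormedSpace.norm_le_dual_bound ℂ _ (by positivity) fun y => by
      change ‖y (f.exists_linearization_apply φ).choose‖ ≤ _
      rw [(f.exists_linearization_apply φ).choose_spec]
      refine (φ.1.le_opNorm_of_le (f.norm_transpose_le y)).trans_eq ?_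
      change ‖φ‖ * _ = _
      ring)

theorem Hinf.dual_linearization [CompleteSpace F] (f : Hinf U F) (y : StrongDual ℂ F)
    (φ : Ginf U) :
    y (f.linearization φ) = (φ.1 : StrongDual ℂ (Hinf U ℂ)) (f.transpose y) :=
  (f.exists_linearization_apply φ).choose_spec y

theorem Hinf.linearization_gU [CompleteSpace F] (f : Hinf U F) (x : U) :
    f.linearization (gU U x) = f x := by
  refine (SeparatingDual.eq_iff_forall_dual_eq (R := ℂ)).2 fun y => ?_
  rw [f.dual_linearization]
  rfl

theorem Hinf.norm_dual_linearization_le [CompleteSpace F] (f : Hinf U F) (y : StrongDual ℂ F)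
    (φ : Ginf U) : ‖y (f.linearization φ)‖ ≤ ‖f.transpose y‖ * ‖φ‖ := by
  rw [f.dual_linearization, mul_comm]
  exact φ.1.le_opNorm _

end Hinf

/-! ### Transfer of the summing constants between `f` and its factorizations -/

section Constants

theorem lpNorm_nonneg {X : Type u} [NormedAddCommGroup X] {p : ℝ≥0∞} (hp : 1 ≤ p) {n : ℕ}
    (x : Fin n → X) : 0 ≤ lpNorm p x :=
  haveI : Fact (1 ≤ p) := ⟨hp⟩
  norm_nonneg _

theorem lpNorm_le_mul {X : Type u} [NormedAddCommGroup X] {Y : Type v} [NormedAddCommGroup Y]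
    {p : ℝ≥0∞} (hp : 1 ≤ p) {n : ℕ} {x : Fin n → X} {y : Fin n → Y} {c : ℝ} (hc : 0 ≤ c)
    (h : ∀ i, ‖x i‖ ≤ c * ‖y i‖) : lpNorm p x ≤ c * lpNorm p y := by
  rcases eq_or_ne p ∞ with rfl | hp'
  · have hb : BddAbove (range fun i => ‖y i‖) := (finite_range _).bddAbove
    refine Real.iSup_le (fun i => (h i).trans ?_) (mul_nonneg hc (lpNorm_nonneg hp y))
    exact mul_le_mul_of_nonneg_left (le_ciSup hb i) hc
  · have hpos : 0 < p.toReal := ENNReal.toReal_pos (zero_lt_one.trans_le hp).ne' hp'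
    rw [lpNorm, lpNorm, PiLp.norm_eq_sum hpos, PiLp.norm_eq_sum hpos]
    have hsum : ∑ i, ‖x i‖ ^ p.toReal ≤ c ^ p.toReal * ∑ i, ‖y i‖ ^ p.toReal := by
      rw [Finset.mul_sum]
      refine Finset.sum_le_sum fun i _ => ?_
      rw [← Real.mul_rpow hc (norm_nonneg _)]
      exact Real.rpow_le_rpow (norm_nonneg _) (h i) hpos.le
    calc (∑ i, ‖x i‖ ^ p.toReal) ^ (1 / p.toReal)
        ≤ (c ^ p.toReal * ∑ i, ‖y i‖ ^ p.toReal) ^ (1 / p.toReal) :=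
          Real.rpow_le_rpow (by positivity) hsum (by positivity)
      _ = c * (∑ i, ‖y i‖ ^ p.toReal) ^ (1 / p.toReal) := by
          rw [Real.mul_rpow (by positivity) (by positivity), ← Real.rpow_mul hc,
            mul_one_div_cancel hpos.ne', Real.rpow_one]

theorem weakNorm_nonneg {F : Type v} [NormedAddCommGroup F] [NormedSpace ℂ F] {q : ℝ≥0∞}
    (hq : 1 ≤ q) {n : ℕ} (y : Fin n → StrongDual ℂ F) : 0 ≤ weakNorm q y :=
  Real.iSup_nonneg fun _ => lpNorm_nonneg hq _

theorem one_le_conjExponent (p : ℝ≥0∞) : 1 ≤ p.conjExponent := le_self_add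

theorem le_csInf_mul {S : Set ℝ} (hS : S.Nonempty) {a K : ℝ} (hK : 0 ≤ K)
    (h : ∀ C ∈ S, a ≤ C * K) : a ≤ sInf S * K := by
  rcases hK.eq_or_lt with rfl | hK
  · obtain ⟨C, hC⟩ := hS
    simpa using h C hC
  · rw [← div_le_iff₀ hK]
    exact le_csInf hS fun C hC => (div_le_iff₀ hK).2 (h C hC)

variable {E : Type u} [NormedAddCommGroup E] [NormedSpace ℂ E] {U : Opens E}
  {F : Type v} [NormedAddCommGroup F] [NormedSpace ℂ F]
  {G : Type w} [NormedAddCommGroup G] [NormedSpace ℂ G] {p : ℝ≥0∞}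

/-- The infimum of admissible constants is itself admissible, since each inequality is closed in
`C`. -/
theorem dLinear_mem (hp : 1 ≤ p) {T : G →L[ℂ] F} (hT : IsStronglySumming p T) :
    dLinear p T ∈ linearConstants p T := by
  refine ⟨le_csInf hT fun C hC => hC.1, fun n x y => ?_⟩
  rw [mul_assoc]
  refine le_csInf_mul hT (mul_nonneg (lpNorm_nonneg hp x)
    (weakNorm_nonneg (one_le_conjExponent p) y)) fun C hC => ?_
  rw [← mul_assoc]
  exact hC.2 n x y

theorem bddBelow_linearConstants (T : G →L[ℂ] F) : BddBelow (linearConstants p T) :=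
  ⟨0, fun _ hC => hC.1⟩

theorem bddBelow_holomorphicConstants (f : U → F) : BddBelow (holomorphicConstants p f) :=
  ⟨0, fun _ hC => hC.1⟩

theorem mul_norm_mem_holomorphicConstants (hp : 1 ≤ p) {T : G →L[ℂ] F} (g : Hinf U G) {C : ℝ}
    (hC : C ∈ linearConstants p T) : C * ‖g‖ ∈ holomorphicConstants p (T ∘ g) := by
  refine ⟨mul_nonneg hC.1 (norm_nonneg g), fun n l x y => ?_⟩
  -- By linearity the scalars are absorbed into the test vectors `λ_i g(x_i)`.
  calc ∑ i, ‖l i‖ * ‖y i ((T ∘ g) (x i))‖ = ∑ i, ‖y i (T (l i • g (x i)))‖ := by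
        simp
    _ ≤ C * lpNorm p (fun i => l i • g (x i)) * weakNorm p.conjExponent y := hC.2 n _ y
    _ ≤ C * (‖g‖ * lpNorm p l) * weakNorm p.conjExponent y := by
        refine mul_le_mul_of_nonneg_right (mul_le_mul_of_nonneg_left ?_ hC.1)
          (weakNorm_nonneg (one_le_conjExponent p) y)
        refine lpNorm_le_mul hp (norm_nonneg g) fun i => ?_
        rw [norm_smul, mul_comm]
        exact mul_le_mul_of_nonneg_right (g.norm_apply_le _) (norm_nonneg _)
    _ = C * ‖g‖ * lpNorm p l * weakNorm p.conjExponent y := by ring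

theorem dHolomorphic_comp_le (hp : 1 ≤ p) {T : G →L[ℂ] F} (hT : IsStronglySumming p T)
    (g : Hinf U G) : dHolomorphic p (T ∘ g) ≤ dLinear p T * ‖g‖ :=
  csInf_le (bddBelow_holomorphicConstants _)
    (mul_norm_mem_holomorphicConstants hp g (dLinear_mem hp hT))

/-- A strongly summing operator composed with a contraction is strongly summing with the same
constants. -/
theorem linearConstants_subset_comp (hp : 1 ≤ p) (T : G →L[ℂ] F)
    {H : Type*} [NormedAddCommGroup H] [NormedSpace ℂ H] (S : H →L[ℂ] G) (hS : ‖S‖ ≤ 1) :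
    linearConstants p T ⊆ linearConstants p (T ∘L S) := fun C hC => by
  refine ⟨hC.1, fun n x y => (hC.2 n (fun i => S (x i)) y).trans ?_⟩
  refine mul_le_mul_of_nonneg_right (mul_le_mul_of_nonneg_left ?_ hC.1)
    (weakNorm_nonneg (one_le_conjExponent p) y)
  refine (lpNorm_le_mul hp zero_le_one fun i => ?_).trans_eq (one_mul _)
  exact S.le_of_opNorm_le hS _

theorem Hinf.exists_norm_sub_lt [Nonempty U] (f : Hinf U F) {ε : ℝ} (hε : 0 < ε) :
    ∃ x, ‖f‖ - ε < ‖f x‖ := by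
  refine exists_lt_of_lt_ciSup ?_
  rw [← f.norm_eq]
  exact sub_lt_self _ hε

theorem holomorphicConstants_subset_linearization [CompleteSpace F] (hp : 1 ≤ p) (f : Hinf U F) :
    holomorphicConstants p f ⊆ linearConstants p f.linearization := fun C hC => by
  refine ⟨hC.1, fun n φ y => ?_⟩
  have hK : 0 ≤ C * lpNorm p φ * weakNorm p.conjExponent y :=
    mul_nonneg (mul_nonneg hC.1 (lpNorm_nonneg hp φ)) (weakNorm_nonneg (one_le_conjExponent p) y)
  rcases isEmpty_or_nonempty U with hU | hU
  -- For empty `U` there are no points to choose, but every `y ∘ f` is zero.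
  · refine (Finset.sum_nonpos fun i _ => ?_).trans hK
    refine (f.norm_dual_linearization_le _ _).trans_eq ?_
    have : f.transpose (y i) = 0 := Hinf.ext fun x => hU.elim x
    rw [this, norm_zero, zero_mul]
  have hε : ∀ ε > 0, ∑ i, ‖y i (f.linearization (φ i))‖ ≤
      C * lpNorm p φ * weakNorm p.conjExponent y + ε * ∑ i, ‖φ i‖ := by
    intro ε hε
    -- The suprema need not be attained: points within `ε` of them cost `ε ∑ ‖φ_i‖`, which vanishes
    -- as `ε → 0`.
    choose x hx using fun i => (f.transpose (y i)).exists_norm_sub_lt hε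
    calc ∑ i, ‖y i (f.linearization (φ i))‖
        ≤ ∑ i, (‖((‖φ i‖ : ℝ) : ℂ)‖ * ‖y i (f (x i))‖ + ε * ‖φ i‖) := by
          refine Finset.sum_le_sum fun i _ => (f.norm_dual_linearization_le _ _).trans ?_
          have h : ‖f.transpose (y i)‖ ≤ ‖y i (f (x i))‖ + ε := by
            have := hx i
            rw [Hinf.transpose_apply] at this
            linarith
          rw [Complex.norm_real, norm_norm]
          nlinarith [mul_le_mul_of_nonneg_right h (norm_nonneg (φ i))]
      _ = ∑ i, ‖((‖φ i‖ : ℝ) : ℂ)‖ * ‖y i (f (x i))‖ + ε * ∑ i, ‖φ i‖ := by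
          rw [Finset.sum_add_distrib, Finset.mul_sum]
      _ ≤ C * lpNorm p (fun i => ((‖φ i‖ : ℝ) : ℂ)) * weakNorm p.conjExponent y
            + ε * ∑ i, ‖φ i‖ := by
          gcongr
          exact hC.2 n _ x y
      _ ≤ _ := by
          gcongr
          · exact weakNorm_nonneg (one_le_conjExponent p) y
          · exact hC.1
          · refine (lpNorm_le_mul hp zero_le_one fun i => ?_).trans_eq (one_mul _)
            simp
  have ht : Tendsto (fun ε : ℝ => C * lpNorm p φ * weakNorm p.conjExponent y + ε * ∑ i, ‖φ i‖)
      (𝓝[>] 0) (𝓝 (C * lpNorm p φ * weakNorm p.conjExponent y)) := by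
    have : Continuous fun ε : ℝ =>
      C * lpNorm p φ * weakNorm p.conjExponent y + ε * ∑ i, ‖φ i‖ := by fun_prop
    simpa using (this.tendsto 0).mono_left nhdsWithin_le_nhds
  exact ge_of_tendsto ht (eventually_mem_nhdsWithin.mono hε)

theorem isStronglySumming_linearization [CompleteSpace F] (hp : 1 ≤ p) {f : Hinf U F}
    (hf : IsCohenStronglySumming p f) : IsStronglySumming p f.linearization :=
  hf.2.mono (holomorphicConstants_subset_linearization hp f)

theorem dLinear_linearization_le [CompleteSpace F] (hp : 1 ≤ p) {f : Hinf U F}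
    (hf : IsCohenStronglySumming p f) : dLinear p f.linearization ≤ dHolomorphic p f :=
  csInf_le_csInf (bddBelow_linearConstants _) hf.2 (holomorphicConstants_subset_linearization hp f)

/-- Any factorization through a contractive copy of Mujica's factorization is optimal. -/
theorem dLinear_comp_mul_norm_eq [CompleteSpace F] (hp : 1 ≤ p) {f : Hinf U F}
    (hf : IsCohenStronglySumming p f) (S : G →L[ℂ] Ginf U) (hS : ‖S‖ ≤ 1) (g : Hinf U G)
    (hg : ‖g‖ ≤ 1) (hfac : (f : U → F) = (f.linearization ∘L S) ∘ g) :
    IsStronglySumming p (f.linearization ∘L S) ∧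
      dLinear p (f.linearization ∘L S) * ‖g‖ = dHolomorphic p f := by
  have hsub := linearConstants_subset_comp hp f.linearization S hS
  have hT := isStronglySumming_linearization hp hf
  have hTS : IsStronglySumming p (f.linearization ∘L S) := hT.mono hsub
  refine ⟨hTS, le_antisymm ?_ ?_⟩
  -- Only `‖g‖ ≤ 1` is needed, so empty `U`, where `‖g‖ = 0`, is covered too.
  · exact (mul_le_of_le_one_right (dLinear_mem hp hTS).1 hg).trans
      ((csInf_le_csInf (bddBelow_linearConstants _) hT hsub).trans (dLinear_linearization_le hp hf))
  · rw [hfac]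
    exact dHolomorphic_comp_le hp hTS g

end Constants

end CohenHolomorphic

theorem mainTheorem5 {E : Type u} [NormedAddCommGroup E] [NormedSpace ℂ E] [CompleteSpace E]
    {F : Type v} [NormedAddCommGroup F] [NormedSpace ℂ F] [CompleteSpace F]
    (U : TopologicalSpace.Opens E) (p : ENNReal) (hp : 1 < p) (f : CohenHolomorphic.Hinf U F) :
    (CohenHolomorphic.IsCohenStronglySumming p f ↔
      ∃ (G : Type (max u w)) (_ : NormedAddCommGroup G) (_ : NormedSpace ℂ G)
        (_ : CompleteSpace G) (g : CohenHolomorphic.Hinf U G) (T : G →L[ℂ] F),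
        CohenHolomorphic.IsStronglySumming p T ∧ (f : U → F) = T ∘ g) ∧
    (CohenHolomorphic.IsCohenStronglySumming p f →
      IsLeast {c : ℝ | ∃ (G : Type (max u w)) (_ : NormedAddCommGroup G) (_ : NormedSpace ℂ G)
          (_ : CompleteSpace G) (g : CohenHolomorphic.Hinf U G) (T : G →L[ℂ] F),
          CohenHolomorphic.IsStronglySumming p T ∧ (f : U → F) = T ∘ g ∧
          c = CohenHolomorphic.dLinear p T * ‖g‖}
        (CohenHolomorphic.dHolomorphic p f) ∧
      ∃ (g : CohenHolomorphic.Hinf U (CohenHolomorphic.Ginf U))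
        (T : CohenHolomorphic.Ginf U →L[ℂ] F),
        (g : U → CohenHolomorphic.Ginf U) = CohenHolomorphic.gU U ∧
        (f : U → F) = T ∘ CohenHolomorphic.gU U ∧
        (∀ S : CohenHolomorphic.Ginf U →L[ℂ] F,
          (f : U → F) = S ∘ CohenHolomorphic.gU U → S = T) ∧
        CohenHolomorphic.IsStronglySumming p T ∧
        CohenHolomorphic.dLinear p T * ‖g‖ =
          CohenHolomorphic.dHolomorphic p f) := by
  have hp' : 1 ≤ p := hp.le
  have lifted : CohenHolomorphic.IsCohenStronglySumming p f →
      ∃ (G : Type (max u w)) (_ : NormedAddCommGroup G) (_ : NormedSpace ℂ G)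
        (_ : CompleteSpace G) (g : CohenHolomorphic.Hinf U G) (T : G →L[ℂ] F),
        CohenHolomorphic.IsStronglySumming p T ∧ (f : U → F) = T ∘ g ∧
        CohenHolomorphic.dHolomorphic p f = CohenHolomorphic.dLinear p T * ‖g‖ := by
    intro hf
    -- `𝒢^∞(U)` lives in universe `u`, so an isometric copy serves as the witness in `Type (max u
    -- w)`.
    let e : ULift.{w} (CohenHolomorphic.Ginf U) ≃ₗᵢ[ℂ] CohenHolomorphic.Ginf U :=
      LinearIsometryEquiv.ulift ℂ (CohenHolomorphic.Ginf U)
    let g : CohenHolomorphic.Hinf U (ULift.{w} (CohenHolomorphic.Ginf U)) :=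
      (CohenHolomorphic.gUHinf U).postcomp e.symm.toContinuousLinearEquiv.toContinuousLinearMap
    have hg : ‖g‖ ≤ 1 :=
      CohenHolomorphic.Hinf.norm_le _ zero_le_one CohenHolomorphic.norm_gU_le
    have hfac : (f : U → F) =
        (f.linearization ∘L e.toContinuousLinearEquiv.toContinuousLinearMap) ∘ g :=
      funext fun x => (f.linearization_gU x).symm
    obtain ⟨h1, h2⟩ := CohenHolomorphic.dLinear_comp_mul_norm_eq hp' hf
      e.toContinuousLinearEquiv.toContinuousLinearMap
      e.toLinearIsometry.norm_toContinuousLinearMap_le g hg hfac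
    exact ⟨_, _, _, inferInstance, g, _, h1, hfac, h2.symm⟩
  refine ⟨⟨fun hf => ?_, ?_⟩, fun hf => ⟨⟨lifted hf, ?_⟩, ?_⟩⟩
  · obtain ⟨G, i₁, i₂, i₃, g, T, hT, hfac, -⟩ := lifted hf
    exact ⟨G, i₁, i₂, i₃, g, T, hT, hfac⟩
  · rintro ⟨G, _, _, _, g, T, ⟨C, hC⟩, hfac⟩
    refine ⟨f.2, C * ‖g‖, ?_⟩
    rw [hfac]
    exact CohenHolomorphic.mul_norm_mem_holomorphicConstants hp' g hC
  · rintro _ ⟨G, _, _, _, g, T, hT, hfac, rfl⟩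
    rw [hfac]
    exact CohenHolomorphic.dHolomorphic_comp_le hp' hT g
  · have hfac : (f : U → F) = f.linearization ∘ CohenHolomorphic.gU U :=
      funext fun x => (f.linearization_gU x).symm
    obtain ⟨h1, h2⟩ := CohenHolomorphic.dLinear_comp_mul_norm_eq hp' hf
      (ContinuousLinearMap.id ℂ (CohenHolomorphic.Ginf U)) ContinuousLinearMap.norm_id_le
      (CohenHolomorphic.gUHinf U) (CohenHolomorphic.norm_gUHinf_le U) hfac
    refine ⟨CohenHolomorphic.gUHinf U, f.linearization, rfl, hfac, fun S hS => ?_, h1, h2⟩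
    exact CohenHolomorphic.Ginf.hom_ext fun x => by
      rw [f.linearization_gU]
      exact (congrFun hS x).symm
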